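/- Let $K$ be a field and let $G$ be a finite simple graph with non-empty vertex set $V_G$, edge set $E_G$ and no isolated vertices. Let $b_0(G)$ be the number of connected components of $G$. Let $K[V_G]=K[x_i : i\in V_G]$ and $K[E_G]=K[t_e : e\in E_G]$ be the standard graded polynomial rings, let $\theta\colon K[E_G]\to K[V_G]$ be the $K$-algebra homomorphism with $\theta(t_e)=x_ix_j$ for every edge $e=\{i,j\}$, and let $I(X_G)=\theta^{-1}\big((x_i^2-x_j^2 : i,j\in V_G)\big)$, a homogeneous ideal of $K[E_G]$. For a finitely generated graded $K[E_G]$-module $M$ with graded Betti numbers $\beta_{i,j}(M)=\dim_K \operatorname{Tor}_i^{K[E_G]}(M,K)_j$, the Castelnuovo--Mumford regularity is $\operatorname{reg} M=\max\{j-i : \beta_{i,j}(M)\neq 0\}$, and one puts $\operatorname{reg} I(X_G)=\operatorname{reg}\big(K[E_G]/I(X_G)\big)+1$ (so that the zero ideal has regularity $1$). Then $$ \operatorname{reg} I(X_G)\leq \begin{cases} |V_G|-b_0(G), & \text{if $G$ is bipartite},\\ |V_G|-b_0(G)+1, & \text{if $G$ is non-bipartite}. \end{cases} $$ -/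

import Mathlib

open MvPolynomial

/-! ## Graded Betti numbers and Castelnuovo-Mumford regularity

Let `S = K[t_e : e ∈ σ]` with its standard grading, and let `M` be a `ℤ`-graded `S`-module, with
graded pieces `𝓜 d`. The graded Betti numbers of `M` are
`β_{i,j}(M) = dim_K Tor_i^S(M, K)_j` (for finitely generated `M`, this is the number of generators
of degree `j` of the `i`-th module of the minimal graded free resolution of `M`).
`Tor_i^S(M, K)` is the homology of `M ⊗_S 𝒦`, where `𝒦` is the Koszul complex of the variables,
which is the minimal graded free resolution of `K`. In homological degree `i` the complex
`M ⊗_S 𝒦` is `M ⊗_K ⋀^i S_1`, i.e. the space of alternating `i`-forms on `K^σ` (the dual of `S_1`)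
with values in `M`: the element `∑_A m_A ⊗ (t_{a_1} ∧ ⋯ ∧ t_{a_i})` is the form whose
value on the standard basis vectors indexed by `a_1, …, a_i` is `m_A`. -/

section Regularity

variable {K σ M : Type*} [Field K] [Fintype σ] [DecidableEq σ] [AddCommGroup M] [Module K M]
  [Module (MvPolynomial σ K) M] [IsScalarTower K (MvPolynomial σ K) M]

variable (K σ M) in
/-- The Koszul differential `M ⊗ ⋀^(i+1) S_1 → M ⊗ ⋀^i S_1`, with
`(∂ c)(v_1, …, v_i) = ∑_e t_e • c(ε_e, v_1, …, v_i)`; in the usual notation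
`∂ (m ⊗ t_{a_0} ∧ ⋯ ∧ t_{a_i}) = ∑_k (-1)^k t_{a_k} m ⊗ (⋯ omit t_{a_k} ⋯)`. -/
noncomputable def koszulD (i : ℕ) :
    ((σ → K) [⋀^Fin (i + 1)]→ₗ[K] M) →ₗ[K] ((σ → K) [⋀^Fin i]→ₗ[K] M) where
  toFun c := ∑ e : σ, (X e : MvPolynomial σ K) • c.curryLeft (Pi.single e 1)
  map_add' c c' := by
    simp [smul_add, Finset.sum_add_distrib]
  map_smul' a c := by
    simp only [AlternatingMap.curryLeft_smul, LinearMap.smul_apply, RingHom.id_apply,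
      Finset.smul_sum]
    exact Finset.sum_congr rfl fun e _ => smul_comm _ _ _

theorem koszulD_apply (i : ℕ) (c : (σ → K) [⋀^Fin (i + 1)]→ₗ[K] M) (v : Fin i → σ → K) :
    koszulD K σ M i c v
      = ∑ e : σ, (X e : MvPolynomial σ K) • c (Matrix.vecCons (Pi.single e 1) v) := by
  have h : ∀ (s : Finset σ) (f : σ → (σ → K) [⋀^Fin i]→ₗ[K] M),
      (∑ e ∈ s, f e) v = ∑ e ∈ s, f e v := fun s f => by
    induction s using Finset.cons_induction with
    | empty => simp
    | cons a s ha ih => rw [Finset.sum_cons, Finset.sum_cons, AlternatingMap.add_apply, ih]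
  simp [koszulD, h]

/-- The Koszul differential squares to zero. -/
theorem koszulD_koszulD (i : ℕ) (c : (σ → K) [⋀^Fin (i + 2)]→ₗ[K] M) :
    koszulD K σ M i (koszulD K σ M (i + 1) c) = 0 := by
  ext v
  simp only [koszulD_apply, Finset.smul_sum, smul_smul, AlternatingMap.zero_apply]
  rw [← Finset.sum_product']
  refine Finset.sum_involution (fun p _ => (p.2, p.1)) ?_ ?_ (by simp) (by simp)
  · rintro ⟨a, b⟩ -
    have h := c.map_swap (Matrix.vecCons (Pi.single b 1) (Matrix.vecCons (Pi.single a 1) v))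
      (i := 0) (j := 1) (by simp)
    have h2 : (Matrix.vecCons (Pi.single b (1 : K)) (Matrix.vecCons (Pi.single a 1) v)) ∘
        (Equiv.swap (0 : Fin (i + 2)) 1) =
        Matrix.vecCons (Pi.single a 1) (Matrix.vecCons (Pi.single b 1) v) := by
      funext k
      refine Fin.cases ?_ (fun k => Fin.cases ?_ (fun k => ?_) k) k
      · simp
      · simp
      · rw [Function.comp_apply, Equiv.swap_apply_of_ne_of_ne]
        · simp
        · exact Fin.succ_ne_zero _
        · rw [← Fin.succ_zero_eq_one]
          exact fun h => Fin.succ_ne_zero _ (Fin.succ_injective _ h)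
    rw [h2] at h
    rw [h, mul_comm (X b)]
    simp
  · rintro ⟨a, b⟩ - hne heq
    apply hne
    have hab : b = a := congrArg Prod.fst heq
    subst hab
    rw [c.map_eq_zero_of_eq _ (i := 0) (j := 1) (by simp) (by simp), smul_zero]

/-- The component of internal degree `j` of the Koszul complex of `M` in homological
degree `i`, namely `M_{j-i} ⊗ ⋀^i S_1`. -/
def koszulChains (𝓜 : ℤ → Submodule K M) (i : ℕ) (j : ℤ) :
    Submodule K ((σ → K) [⋀^Fin i]→ₗ[K] M) where
  carrier := {c | ∀ v, c v ∈ 𝓜 (j - i)}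
  add_mem' h h' v := add_mem (h v) (h' v)
  zero_mem' _ := zero_mem _
  smul_mem' a _ h v := Submodule.smul_mem _ a (h v)

/-- Koszul cycles of homological degree `i` and internal degree `j`. -/
noncomputable def koszulCycles (𝓜 : ℤ → Submodule K M) :
    (i : ℕ) → ℤ → Submodule K ((σ → K) [⋀^Fin i]→ₗ[K] M)
  | 0, j => koszulChains 𝓜 0 j
  | i + 1, j => koszulChains 𝓜 (i + 1) j ⊓ LinearMap.ker (koszulD K σ M i)

/-- Koszul boundaries of homological degree `i` and internal degree `j`. -/
noncomputable def koszulBoundaries (𝓜 : ℤ → Submodule K M) (i : ℕ) (j : ℤ) :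
    Submodule K ((σ → K) [⋀^Fin i]→ₗ[K] M) :=
  (koszulChains 𝓜 (i + 1) j).map (koszulD K σ M i)

variable (σ) in
/-- The graded Betti number `β_{i,j}(M) = dim_K Tor_i^S(M, K)_j`, the dimension of the Koszul
homology in homological degree `i` and internal degree `j`. -/
noncomputable def gradedBetti (𝓜 : ℤ → Submodule K M) (i : ℕ) (j : ℤ) : Cardinal :=
  Module.rank K (koszulCycles (σ := σ) 𝓜 i j ⧸
    (koszulBoundaries (σ := σ) 𝓜 i j).submoduleOf (koszulCycles 𝓜 i j))

variable (σ) in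
/-- The Castelnuovo-Mumford regularity `reg M = max {j - i : β_{i,j}(M) ≠ 0}` of a graded
module over `S = K[t_e : e ∈ σ]`, as a supremum in the extended reals
(so that no junk value can occur). -/
noncomputable def cmRegularity (𝓜 : ℤ → Submodule K M) : EReal :=
  ⨆ (i : ℕ) (j : ℤ) (_ : gradedBetti σ 𝓜 i j ≠ 0), (((j - i : ℤ) : ℝ) : EReal)

/-- The standard grading of `S / I`, for a homogeneous ideal `I`: the piece of degree `n ≥ 0` is
the image of the forms of degree `n`, and the pieces of negative degree are zero. -/
noncomputable def quotientGrading (I : Ideal (MvPolynomial σ K)) :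
    ℤ → Submodule K (MvPolynomial σ K ⧸ I)
  | Int.ofNat n => (homogeneousSubmodule σ K n).map (Ideal.Quotient.mkₐ K I).toLinearMap
  | Int.negSucc _ => ⊥

/-- The regularity of a proper homogeneous ideal `I` of `S`, `reg I = reg (S / I) + 1`;
in particular the zero ideal has regularity `1`. -/
noncomputable def cmRegularityIdeal (I : Ideal (MvPolynomial σ K)) : EReal :=
  cmRegularity σ (quotientGrading I) + 1

end Regularity

/-! ## The ideal of a graph -/

section GraphIdeal

variable {V : Type*}

/-- The homomorphism `θ : K[E_G] → K[V_G]`, `t_e ↦ x_i x_j` for `e = {i, j}`. -/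
noncomputable def edgeHom (G : SimpleGraph V) (K : Type*) [Field K] :
    MvPolynomial G.edgeSet K →ₐ[K] MvPolynomial V K :=
  aeval fun e : G.edgeSet => ((e : Sym2 V).map (X : V → MvPolynomial V K)).mul

/-- The ideal `I(X_G) = θ⁻¹ (x_i² - x_j² : i, j ∈ V_G)` of `K[E_G]`. -/
noncomputable def graphIdeal (G : SimpleGraph V) (K : Type*) [Field K] :
    Ideal (MvPolynomial G.edgeSet K) :=
  (Ideal.span {p | ∃ i j : V, p = (X i ^ 2 - X j ^ 2 : MvPolynomial V K)}).comap (edgeHom G K)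

end GraphIdeal

/-! Send `t_e` to the group element (boundary of `e` in `𝔽₂^V`, `2`) of `K[𝔽₂^V × ℤ]`. The kernel is
`I(X_G)` (`graphIdeal_eq_ker`), so each `t_e` becomes a unit and is a nonzerodivisor on `S/I`. Fix
one edge `e`. If multiplication by `t_e` is also onto in every degree above `r`, then wedging with
`t_e` contracts the Koszul complex there, and `reg (S/I) ≤ r` (`cmRegularity_le`).

Surjectivity is a pigeonhole over `𝔽₂` (`exists_linearCombination_add_eq`). Let `N` be the rank of
the vectors (boundary, `1`). A monomial of degree at least `N`, times `t_e`, contains a nontrivial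
factor of weight zero; its degree is even, so it may be traded for a power of `t_e`. Hence `r = N -
1` works and `reg I ≤ N`.

Boundaries sum to zero on each component, so they span at most `|V| - b₀` dimensions. The last
coordinate adds at most one, and nothing when a 2-colouring makes it a function of the boundary. -/

/-! ### Koszul homotopy and vanishing of Betti numbers. -/

section KoszulHomotopy

variable {K σ M : Type*} [Field K] [AddCommGroup M] [Module K M]

/-- Exterior multiplication by the variable `t_e`, i.e. `c ↦ t_e ∧ c`, on the Koszul complex. -/
noncomputable def koszulWedge (e : σ) {i : ℕ} (c : (σ → K) [⋀^Fin i]→ₗ[K] M) :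
    (σ → K) [⋀^Fin (i + 1)]→ₗ[K] M :=
  AlternatingMap.alternatizeUncurryFin ((LinearMap.proj e : (σ → K) →ₗ[K] K).smulRight c)

theorem koszulWedge_apply (e : σ) {i : ℕ} (c : (σ → K) [⋀^Fin i]→ₗ[K] M)
    (v : Fin (i + 1) → σ → K) :
    koszulWedge e c v = ∑ k : Fin (i + 1), (-1) ^ (k : ℕ) • v k e • c (k.removeNth v) := by
  simp [koszulWedge, AlternatingMap.alternatizeUncurryFin_apply]

variable [Fintype σ] [DecidableEq σ] [Module (MvPolynomial σ K) M]
  [IsScalarTower K (MvPolynomial σ K) M]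

theorem koszulD_koszulWedge_zero (e : σ) (c : (σ → K) [⋀^Fin 0]→ₗ[K] M) (v : Fin 0 → σ → K) :
    koszulD K σ M 0 (koszulWedge e c) v = (X e : MvPolynomial σ K) • c v := by
  have h : ∀ f : σ, koszulWedge e c (Matrix.vecCons (Pi.single f 1) v)
      = (Pi.single f 1 : σ → K) e • c v := by
    intro f
    rw [koszulWedge_apply, Fin.sum_univ_succ, Fin.sum_univ_zero, add_zero, Fin.val_zero, pow_zero,
      one_smul, Matrix.cons_val_zero]
    congr 2
  rw [koszulD_apply, Finset.sum_eq_single e]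
  · simp [h]
  · intro f _ hf
    simp [h, hf.symm]
  · simp

/-- The homotopy formula `∂(t_e ∧ c) + t_e ∧ ∂c = t_e c`: omitting the new slot gives `t_e c`, and
every other omission shifts by one place, which flips its sign. -/
theorem koszulD_koszulWedge_succ (e : σ) {i : ℕ} (c : (σ → K) [⋀^Fin (i + 1)]→ₗ[K] M)
    (v : Fin (i + 1) → σ → K) :
    koszulD K σ M (i + 1) (koszulWedge e c) v =
      (X e : MvPolynomial σ K) • c v - koszulWedge e (koszulD K σ M i c) v := by
  have hrem : ∀ (x : σ → K) (k : Fin (i + 1)),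
      (k.succ.removeNth (Matrix.vecCons x v) : Fin (i + 1) → σ → K)
        = Matrix.vecCons x (k.removeNth v) := by
    intro x k
    funext l
    refine Fin.cases ?_ (fun l => ?_) l <;> simp [Fin.removeNth]
  have hrem0 : ∀ x : σ → K, ((0 : Fin (i + 2)).removeNth (Matrix.vecCons x v)) = v := by
    intro x
    funext l
    simp [Fin.removeNth]
  simp only [koszulD_apply, koszulWedge_apply]
  simp only [Fin.sum_univ_succ (n := i + 1), hrem, hrem0, smul_add, Finset.sum_add_distrib,
    Matrix.cons_val_zero, Matrix.cons_val_succ, Fin.val_zero, pow_zero, one_smul, Fin.val_succ]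
  rw [sub_eq_add_neg]
  congr 1
  · rw [Finset.sum_eq_single e]
    · simp
    · intro f _ hf
      simp [hf.symm]
    · simp
  · simp only [Finset.smul_sum]
    rw [Finset.sum_comm, ← Finset.sum_neg_distrib]
    refine Finset.sum_congr rfl fun k _ => ?_
    rw [← Finset.sum_neg_distrib]
    refine Finset.sum_congr rfl fun f _ => ?_
    rw [pow_succ, mul_neg_one, neg_smul, smul_neg, smul_comm (X f : MvPolynomial σ K) (_ : ℤ),
      smul_comm (X f : MvPolynomial σ K) (v k e)]

variable (𝓜 : ℤ → Submodule K M) (e : σ)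

/-- If multiplication by a variable is injective on `M` and maps `M_{d-1}` onto `M_d`, then the
Koszul homology of `M` is zero in homological degree `i` and internal degree `d + i`. -/
theorem koszulCycles_le_koszulBoundaries
    (hinj : ∀ m : M, (X e : MvPolynomial σ K) • m = 0 → m = 0) (i : ℕ) (j : ℤ)
    (hsurj : ∀ m ∈ 𝓜 (j - i), ∃ a ∈ 𝓜 (j - i - 1), (X e : MvPolynomial σ K) • a = m) :
    koszulCycles (σ := σ) 𝓜 i j ≤ koszulBoundaries (σ := σ) 𝓜 i j := by
  intro c hc
  let μ : M →ₗ[K] M :=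
    { toFun := fun m => (X e : MvPolynomial σ K) • m
      map_add' := smul_add _
      map_smul' := fun a m => smul_comm _ _ _ }
  -- A `K`-linear left inverse divides `c` by `t_e` while keeping it alternating.
  obtain ⟨g, hg⟩ := μ.exists_leftInverse_of_injective
    (LinearMap.ker_eq_bot'.2 fun m hm => hinj m hm)
  have hgμ : ∀ m, g ((X e : MvPolynomial σ K) • m) = m := fun m => LinearMap.congr_fun hg m
  have hchain : ∀ v, c v ∈ 𝓜 (j - i) := by
    cases i with
    | zero => exact hc
    | succ i => exact hc.1
  let c' : (σ → K) [⋀^Fin i]→ₗ[K] M := g.compAlternatingMap c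
  have hc' : ∀ v, c' v ∈ 𝓜 (j - i - 1) ∧ (X e : MvPolynomial σ K) • c' v = c v := by
    intro v
    obtain ⟨a, ha, hav⟩ := hsurj _ (hchain v)
    have : c' v = a := by
      change g (c v) = a
      rw [← hav, hgμ]
    rw [this]
    exact ⟨ha, hav⟩
  refine ⟨koszulWedge e c', fun v => ?_, ?_⟩
  · rw [koszulWedge_apply]
    refine Submodule.sum_mem _ fun k _ => ?_
    rw [show j - ((i + 1 : ℕ) : ℤ) = j - i - 1 by push_cast; ring]
    exact zsmul_mem (Submodule.smul_mem _ _ (hc' _).1) _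
  · ext v
    cases i with
    | zero => rw [koszulD_koszulWedge_zero, (hc' v).2]
    | succ i =>
      -- `t_e ∂c' = ∂c = 0`, and `t_e` is injective.
      have hcyc : koszulD K σ M i c' = 0 := by
        ext w
        refine hinj _ ?_
        have := congrArg (fun f => f w) (LinearMap.mem_ker.1 hc.2)
        simp only [koszulD_apply, AlternatingMap.zero_apply] at this
        rw [koszulD_apply, Finset.smul_sum, ← this]
        refine Finset.sum_congr rfl fun f _ => ?_
        rw [smul_comm, (hc' _).2]
      rw [koszulD_koszulWedge_succ, (hc' v).2, hcyc, koszulWedge_apply]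
      simp

theorem gradedBetti_eq_zero
    (hinj : ∀ m : M, (X e : MvPolynomial σ K) • m = 0 → m = 0) (i : ℕ) (j : ℤ)
    (hsurj : ∀ m ∈ 𝓜 (j - i), ∃ a ∈ 𝓜 (j - i - 1), (X e : MvPolynomial σ K) • a = m) :
    gradedBetti σ 𝓜 i j = 0 := by
  have : Subsingleton (koszulCycles (σ := σ) 𝓜 i j ⧸
      (koszulBoundaries (σ := σ) 𝓜 i j).submoduleOf (koszulCycles 𝓜 i j)) := by
    rw [Submodule.Quotient.subsingleton_iff, Submodule.submoduleOf_eq_top]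
    exact koszulCycles_le_koszulBoundaries 𝓜 e hinj i j hsurj
  exact rank_subsingleton' K _

theorem cmRegularity_le {r : ℤ}
    (hinj : ∀ m : M, (X e : MvPolynomial σ K) • m = 0 → m = 0)
    (hsurj : ∀ d : ℤ, r < d → ∀ m ∈ 𝓜 d, ∃ a ∈ 𝓜 (d - 1), (X e : MvPolynomial σ K) • a = m) :
    cmRegularity σ 𝓜 ≤ ((r : ℝ) : EReal) := by
  refine iSup_le fun i => iSup_le fun j => iSup_le fun hβ => ?_
  by_contra h
  refine hβ (gradedBetti_eq_zero 𝓜 e hinj i j (hsurj _ ?_))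
  rw [EReal.coe_le_coe_iff, Int.cast_le] at h
  omega

end KoszulHomotopy

/-! ### Zero-sum submultisets over `𝔽₂`. -/

section LinearAlgebra

variable {σ W : Type*} [AddCommGroup W] [Module (ZMod 2) W]

theorem exists_le_linearCombination_eq_zero [Module.Finite (ZMod 2) W] (w : σ → W) (a : σ →₀ ℕ)
    (ha : Module.finrank (ZMod 2) (Submodule.span (ZMod 2) (Set.range w)) < a.degree) :
    ∃ c ≤ a, c ≠ 0 ∧ Finsupp.linearCombination ℕ w c = 0 := by
  classical
  -- A repeated vector already gives `2 w_f = 0`. Otherwise `a` is squarefree with more vectors than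
  -- the rank, and an `𝔽₂`-dependence lifts to exponents `0`, `1`.
  by_cases h2 : ∃ f, 2 ≤ a f
  · obtain ⟨f, hf⟩ := h2
    refine ⟨Finsupp.single f 2, by simpa using hf, by simp, ?_⟩
    rw [Finsupp.linearCombination_single, ← Nat.cast_smul_eq_nsmul (ZMod 2),
      show ((2 : ℕ) : ZMod 2) = 0 from rfl, zero_smul]
  push Not at h2
  have hsupp : ∀ f ∈ a.support, a f = 1 := by
    intro f hf
    have := h2 f
    have := Finsupp.mem_support_iff.1 hf
    omega
  have hcard : a.degree = a.support.card := by
    rw [Finsupp.degree_apply, Finset.sum_congr rfl hsupp, Finset.sum_const, smul_eq_mul, mul_one]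
  have hdep : ¬ LinearIndepOn (ZMod 2) w (a.support : Set σ) := by
    intro hli
    have hle := Submodule.finrank_mono (R := ZMod 2)
      (Submodule.span_mono (Set.range_comp_subset_range
        (Subtype.val : ↥(a.support : Set σ) → σ) w))
    have hcard' := (finrank_span_eq_card hli).symm.trans_le hle
    rw [← Nat.card_eq_fintype_card, Nat.card_coe_set_eq, Set.ncard_coe_finset] at hcard'
    omega
  rw [not_linearIndepOn_finset_iff] at hdep
  obtain ⟨g, hg, f, hf, hgf⟩ := hdep
  let c : σ →₀ ℕ := Finsupp.onFinset a.support (fun i => if i ∈ a.support then (g i).val else 0)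
    fun i hi => by by_contra h; simp [h] at hi
  refine ⟨c, fun i => ?_, fun h0 => hgf ?_, ?_⟩
  · change (if i ∈ a.support then (g i).val else 0) ≤ a i
    split_ifs with hi
    · rw [hsupp i hi]
      have := ZMod.val_lt (g i)
      omega
    · exact Nat.zero_le _
  · have : c f = (g f).val := if_pos hf
    rwa [h0, Finsupp.zero_apply, eq_comm, ZMod.val_eq_zero] at this
  · rw [← hg, Finsupp.linearCombination_apply, Finsupp.sum_of_support_subset (s := a.support)]
    · refine Finset.sum_congr rfl fun i hi => ?_
      rw [show c i = (g i).val from if_pos hi, ← Nat.cast_smul_eq_nsmul (ZMod 2),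
        ZMod.natCast_zmod_val]
    · exact Finsupp.support_onFinset_subset
    · simp

theorem linearCombination_degree_cast (w : σ → W) (l : W →ₗ[ZMod 2] ZMod 2) (hl : ∀ e, l (w e) = 1)
    (a : σ →₀ ℕ) : l (Finsupp.linearCombination ℕ w a) = a.degree := by
  rw [Finsupp.linearCombination_apply, Finsupp.sum, map_sum, Finsupp.degree_apply, Nat.cast_sum]
  refine Finset.sum_congr rfl fun i _ => ?_
  rw [map_nsmul, hl, nsmul_one]

/-- Adding `e` first pushes the degree strictly above the rank. In `a + e = c + d` with `c` of
weight zero, `l` forces `deg c` to be even, so `c` can be replaced by `deg c` copies of `e`. One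
copy cancels the added `e`, one is split off, and `deg c - 2` remain in `b`. -/
theorem exists_linearCombination_add_eq [Module.Finite (ZMod 2) W] (w : σ → W)
    (l : W →ₗ[ZMod 2] ZMod 2) (hl : ∀ e, l (w e) = 1) (e : σ) (a : σ →₀ ℕ)
    (ha : Module.finrank (ZMod 2) (Submodule.span (ZMod 2) (Set.range w)) ≤ a.degree) :
    ∃ b : σ →₀ ℕ, b.degree + 1 = a.degree ∧
      Finsupp.linearCombination ℕ w (b + Finsupp.single e 1) = Finsupp.linearCombination ℕ w a := by
  obtain ⟨c, hca, hc0, hc⟩ := exists_le_linearCombination_eq_zero w (a + Finsupp.single e 1)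
    (by rw [map_add, Finsupp.degree_single]; omega)
  have hev : Even c.degree := by
    rw [← ZMod.natCast_eq_zero_iff_even, ← linearCombination_degree_cast w l hl, hc, map_zero]
  obtain ⟨k, hk⟩ := hev
  have hpos : c.degree ≠ 0 := by rwa [Ne, Finsupp.degree_eq_zero_iff]
  obtain ⟨d, hd⟩ := exists_add_of_le hca
  refine ⟨d + Finsupp.single e (c.degree - 2), ?_, ?_⟩
  · have := congrArg Finsupp.degree hd
    simp only [map_add, Finsupp.degree_single] at this ⊢
    omega
  · have h := congrArg (Finsupp.linearCombination ℕ w) hd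
    have hz : ∀ m : ℕ, (m + m) • w e = 0 := fun m => by
      rw [← Nat.cast_smul_eq_nsmul (ZMod 2), Nat.cast_add, CharTwo.add_self_eq_zero, zero_smul]
    rw [map_add, map_add, hc, zero_add, Finsupp.linearCombination_single, one_smul] at h
    rw [map_add, map_add, ← h, Finsupp.linearCombination_single, Finsupp.linearCombination_single,
      show c.degree - 2 = (k - 1) + (k - 1) by omega, hz, add_zero, one_smul, add_assoc,
      ← two_nsmul, hz 1, add_zero]

end LinearAlgebra

/-! ### Monomial maps into group algebras. -/

section Toric

variable {σ Γ : Type*} [AddCommGroup Γ] (K : Type*) [Field K]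

/-- The monomial homomorphism `K[x_i : i ∈ σ] → K[Γ]` sending `x_i` to the element `w i` of `Γ`. -/
noncomputable def monomialHom (w : σ → Γ) : MvPolynomial σ K →ₐ[K] AddMonoidAlgebra K Γ :=
  aeval fun i => AddMonoidAlgebra.single (w i) 1

variable {K}

theorem monomialHom_X (w : σ → Γ) (i : σ) :
    monomialHom K w (X i) = AddMonoidAlgebra.single (w i) 1 := by
  simp [monomialHom]

theorem monomialHom_monomial (w : σ → Γ) (a : σ →₀ ℕ) (k : K) :
    monomialHom K w (monomial a k)
      = AddMonoidAlgebra.single (Finsupp.linearCombination ℕ w a) k := by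
  induction a using Finsupp.induction_linear generalizing k with
  | zero =>
    rw [map_zero, ← C_apply, ← MvPolynomial.algebraMap_eq, AlgHom.commutes]
    rfl
  | add a b ha hb =>
    rw [map_add, ← mul_one k, monomial_mul.symm, map_mul, ha, hb,
      AddMonoidAlgebra.single_mul_single]
  | single i n =>
    rw [← C_mul_X_pow_eq_monomial, map_mul, map_pow, monomialHom_X, ← MvPolynomial.algebraMap_eq,
      AlgHom.commutes, AddMonoidAlgebra.single_pow, Finsupp.linearCombination_single, one_pow]
    change AddMonoidAlgebra.single (0 : Γ) k * _ = _
    rw [AddMonoidAlgebra.single_mul_single, zero_add, mul_one]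

/-- A monomial homomorphism is injective modulo any ideal which identifies all monomials
of equal weight. -/
theorem ker_monomialHom_le (w : σ → Γ) (I : Ideal (MvPolynomial σ K))
    (hI : ∀ a b : σ →₀ ℕ, Finsupp.linearCombination ℕ w a = Finsupp.linearCombination ℕ w b →
      Ideal.Quotient.mk I (monomial a 1) = Ideal.Quotient.mk I (monomial b 1)) :
    RingHom.ker (monomialHom K w) ≤ I := by
  let g : (σ →₀ ℕ) → MvPolynomial σ K ⧸ I := fun a => Ideal.Quotient.mk I (monomial a 1)
  -- The value `0` off the attained weights is immaterial: only images of monomials are evaluated.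
  let s : Γ → MvPolynomial σ K ⧸ I := Function.extend (Finsupp.linearCombination ℕ w) g 0
  have hs : ∀ a, s (Finsupp.linearCombination ℕ w a) = g a := fun a =>
    Function.FactorsThrough.extend_apply (fun a b h => hI a b h) 0 a
  let L : AddMonoidAlgebra K Γ →ₗ[K] MvPolynomial σ K ⧸ I :=
    Finsupp.linearCombination K s ∘ₗ (AddMonoidAlgebra.coeffLinearEquiv K).toLinearMap
  have hL : ∀ (γ : Γ) (k : K), L (AddMonoidAlgebra.single γ k) = k • s γ := fun γ k => by
    change Finsupp.linearCombination K s (Finsupp.single γ k) = _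
    rw [Finsupp.linearCombination_single]
  have hcomp : L ∘ₗ (monomialHom K w).toLinearMap = (Ideal.Quotient.mkₐ K I).toLinearMap := by
    refine MvPolynomial.linearMap_ext fun a => LinearMap.ext_ring ?_
    change L (monomialHom K w (monomial a 1)) = Ideal.Quotient.mk I (monomial a 1)
    rw [monomialHom_monomial, hL, one_smul, hs]
  intro p hp
  rw [← Ideal.Quotient.eq_zero_iff_mem]
  have := LinearMap.congr_fun hcomp p
  change L (monomialHom K w p) = Ideal.Quotient.mk I p at this
  rw [← this, (RingHom.mem_ker).1 hp, map_zero]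

/-- `Γ` is a group, so the image of a variable is a unit. -/
theorem mem_ker_monomialHom_of_X_mul_mem (w : σ → Γ) (e : σ) {p : MvPolynomial σ K}
    (h : X e * p ∈ RingHom.ker (monomialHom K w)) : p ∈ RingHom.ker (monomialHom K w) := by
  rw [RingHom.mem_ker, map_mul, monomialHom_X] at h
  rw [RingHom.mem_ker]
  have h2 := congrArg (fun q => AddMonoidAlgebra.single (-w e) (1 : K) * q) h
  simpa only [← mul_assoc, AddMonoidAlgebra.single_mul_single, neg_add_cancel, mul_one, mul_zero,
    ← AddMonoidAlgebra.one_def, one_mul] using h2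

/-- The regularity bound for a toric ideal such that every monomial of degree `> r` has the
weight of a multiple of a fixed variable `t_e`. -/
theorem cmRegularity_ker_monomialHom_le [Fintype σ] [DecidableEq σ] (w : σ → Γ) (e : σ) {r : ℤ}
    (h : ∀ a : σ →₀ ℕ, r < a.degree → ∃ b : σ →₀ ℕ, b.degree + 1 = a.degree ∧
      Finsupp.linearCombination ℕ w (b + Finsupp.single e 1) = Finsupp.linearCombination ℕ w a) :
    cmRegularity σ (quotientGrading (RingHom.ker (monomialHom K w))) ≤ ((r : ℝ) : EReal) := by
  set I := RingHom.ker (monomialHom K w)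
  refine cmRegularity_le _ e ?_ ?_
  · intro m
    obtain ⟨p, rfl⟩ := Ideal.Quotient.mk_surjective m
    intro hp
    rw [Ideal.Quotient.eq_zero_iff_mem]
    refine mem_ker_monomialHom_of_X_mul_mem w e ?_
    rw [← Ideal.Quotient.eq_zero_iff_mem]
    exact hp
  · rintro (n | n) hd m hm
    · obtain ⟨p, hp, rfl⟩ := hm
      rw [SetLike.mem_coe, mem_homogeneousSubmodule] at hp
      rw [p.as_sum, map_sum]
      have hmon : ∀ a ∈ p.support, ∃ x ∈ quotientGrading I (Int.ofNat n - 1),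
          (X e : MvPolynomial σ K) • x
            = (Ideal.Quotient.mkₐ K I).toLinearMap (monomial a (p.coeff a)) := by
        intro a ha
        have han : a.degree = n := by
          rw [Finsupp.degree_eq_weight_one]
          exact hp (mem_support_iff.1 ha)
        obtain ⟨b, hb, hba⟩ := h a (by rw [han]; exact hd)
        refine ⟨Ideal.Quotient.mk I (monomial b (p.coeff a)), ?_, ?_⟩
        · rw [show Int.ofNat n - 1 = Int.ofNat b.degree by
            simp only [Int.ofNat_eq_natCast]; omega]
          exact ⟨_, isHomogeneous_monomial _ rfl, rfl⟩
        · change Ideal.Quotient.mk I (X e * monomial b (p.coeff a)) = Ideal.Quotient.mk I _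
          rw [Ideal.Quotient.mk_eq_mk_iff_sub_mem, RingHom.mem_ker, map_sub, mul_comm,
            ← pow_one (X e), ← monomial_add_single, monomialHom_monomial, hba,
            monomialHom_monomial, sub_self]
      choose! x hx hxe using hmon
      exact ⟨∑ a ∈ p.support, x a, Submodule.sum_mem _ hx, by
        rw [Finset.smul_sum]; exact Finset.sum_congr rfl hxe⟩
    · exact ⟨0, zero_mem _, by rw [smul_zero]; exact ((Submodule.mem_bot K).1 hm).symm⟩

end Toric

/-! ### The ideal of differences of squares as a toric kernel. -/

section VertexIdeal

variable {V : Type*} [DecidableEq V]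

/-- The weight of a vertex variable `x_v`: its exponent vector modulo two, and its degree. -/
def vertexWeight (v : V) : (V → ZMod 2) × ℤ := (Pi.single v 1, 1)

/-- The two endpoints of an edge as an element of `𝔽₂^V`. -/
def edgeBoundary (e : Sym2 V) : V → ZMod 2 :=
  Sym2.lift ⟨fun i j => Pi.single i 1 + Pi.single j 1, fun _ _ => add_comm _ _⟩ e

theorem edgeBoundary_mk (i j : V) :
    edgeBoundary s(i, j) = Pi.single i 1 + Pi.single j 1 := rfl

variable [Fintype V]

theorem linearCombination_vertexWeight (a : V →₀ ℕ) :
    Finsupp.linearCombination ℕ vertexWeight a = (fun v => (a v : ZMod 2), ∑ v, (a v : ℤ)) := by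
  rw [Finsupp.linearCombination_apply, Finsupp.sum_fintype _ _ (by simp)]
  ext v
  · simp [vertexWeight, Prod.fst_sum, Finset.sum_apply, Pi.single_apply]
  · simp [vertexWeight, Prod.snd_sum]

/-- Modulo the ideal all squares agree, so a monomial depends only on its exponent parities and its
number of square factors; the total degree and the parities determine that number. -/
theorem ker_monomialHom_vertexWeight (K : Type*) [Field K] [Nonempty V] :
    RingHom.ker (monomialHom K (vertexWeight (V := V))) =
      Ideal.span {p | ∃ i j : V, p = (X i ^ 2 - X j ^ 2 : MvPolynomial V K)} := by
  set J := Ideal.span {p | ∃ i j : V, p = (X i ^ 2 - X j ^ 2 : MvPolynomial V K)}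
  refine le_antisymm (ker_monomialHom_le _ _ fun a b hab => ?_) (Ideal.span_le.2 ?_)
  · obtain ⟨v₀⟩ := ‹Nonempty V›
    have hsq : ∀ i, Ideal.Quotient.mk J (X i) ^ 2 = Ideal.Quotient.mk J (X v₀) ^ 2 := fun i => by
      rw [← map_pow, ← map_pow, Ideal.Quotient.mk_eq_mk_iff_sub_mem]
      exact Ideal.subset_span ⟨i, v₀, rfl⟩
    have hmon : ∀ c : V →₀ ℕ, Ideal.Quotient.mk J (monomial c 1) =
        (∏ i, Ideal.Quotient.mk J (X i) ^ (c i % 2)) *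
          (Ideal.Quotient.mk J (X v₀) ^ 2) ^ (∑ i, c i / 2) := by
      intro c
      rw [monomial_eq, C_1, one_mul, Finsupp.prod_fintype _ _ (by simp), map_prod,
        ← Finset.prod_pow_eq_pow_sum, ← Finset.prod_mul_distrib]
      refine Finset.prod_congr rfl fun i _ => ?_
      rw [map_pow, ← hsq i, ← pow_mul, ← pow_add, Nat.mod_add_div]
    rw [linearCombination_vertexWeight, linearCombination_vertexWeight, Prod.mk.injEq] at hab
    have hmod : ∀ i, a i % 2 = b i % 2 := fun i =>
      (ZMod.natCast_eq_natCast_iff' _ _ _).1 (congrFun hab.1 i)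
    have hdiv : ∑ i, a i / 2 = ∑ i, b i / 2 := by
      have hsum : ∀ c : V →₀ ℕ, ∑ i, c i = ∑ i, c i % 2 + 2 * ∑ i, c i / 2 := fun c => by
        rw [Finset.mul_sum, ← Finset.sum_add_distrib]
        exact Finset.sum_congr rfl fun i _ => (Nat.mod_add_div _ _).symm
      have ha := hsum a
      have hb := hsum b
      simp only [hmod] at ha
      have : ∑ i, a i = ∑ i, b i := by exact_mod_cast hab.2
      omega
    rw [hmon, hmon, hdiv]
    simp only [hmod]
  · rintro _ ⟨i, j, rfl⟩
    have hw : ∀ k : V, 2 • vertexWeight k = (0, 2) := fun k => by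
      ext v
      · simpa [vertexWeight] using Or.inl (show (2 : ZMod 2) = 0 from rfl)
      · simp [vertexWeight]
    rw [SetLike.mem_coe, RingHom.mem_ker, map_sub, map_pow, map_pow, monomialHom_X, monomialHom_X,
      AddMonoidAlgebra.single_pow, AddMonoidAlgebra.single_pow, hw, hw, sub_self]

end VertexIdeal

/-! ### The dimension `|V| - b₀`. -/

section Components

variable {V : Type*} [Fintype V] (G : SimpleGraph V)

open Classical in
/-- The map `𝔽₂^V → 𝔽₂^π₀(G)` adding up the coordinates in each connected component. -/
noncomputable def componentSum :
    (V → ZMod 2) →ₗ[ZMod 2] (G.ConnectedComponent → ZMod 2) :=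
  Fintype.linearCombination (ZMod 2) fun v => Pi.single (G.connectedComponentMk v) 1

theorem finrank_ker_componentSum :
    Nat.card G.ConnectedComponent + Module.finrank (ZMod 2) (LinearMap.ker (componentSum G)) =
      Fintype.card V := by
  classical
  have : Fintype G.ConnectedComponent := Fintype.ofFinite _
  have hsurj : LinearMap.range (componentSum G) = ⊤ := by
    rw [componentSum, Fintype.range_linearCombination, eq_top_iff,
      ← (Pi.basisFun (ZMod 2) G.ConnectedComponent).span_eq]
    refine Submodule.span_mono ?_
    rintro _ ⟨c, rfl⟩
    induction c using SimpleGraph.ConnectedComponent.ind with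
    | h v => exact ⟨v, by simp⟩
  have h := (componentSum G).finrank_range_add_finrank_ker
  rw [hsurj, finrank_top, Module.finrank_fintype_fun_eq_card, Module.finrank_fintype_fun_eq_card]
    at h
  rw [← h, Nat.card_eq_fintype_card]

end Components

/-! ### Rank of the edge vectors and the regularity bound. -/

section Graph

variable {V : Type*} [DecidableEq V] (G : SimpleGraph V)

/-- The ideal `I(X_G)` is the kernel of the homomorphism which sends a monomial to its boundary
modulo two and (twice) its degree. -/
theorem graphIdeal_eq_ker [Fintype V] [Nonempty V] (K : Type*) [Field K] :
    graphIdeal G K =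
      RingHom.ker (monomialHom K fun e : G.edgeSet => (edgeBoundary (e : Sym2 V), (2 : ℤ))) := by
  have hcomp : (monomialHom K vertexWeight).comp (edgeHom G K) =
      monomialHom K fun e : G.edgeSet => (edgeBoundary (e : Sym2 V), (2 : ℤ)) := by
    refine MvPolynomial.algHom_ext fun e => ?_
    obtain ⟨e, he⟩ := e
    rw [monomialHom_X, AlgHom.comp_apply, edgeHom, aeval_X]
    induction e with
    | h i j =>
      rw [Sym2.map_mk, Sym2.mul_mk, map_mul, monomialHom_X, monomialHom_X,
        AddMonoidAlgebra.single_mul_single, edgeBoundary_mk, mul_one]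
      rfl
  ext p
  rw [graphIdeal, ← ker_monomialHom_vertexWeight, Ideal.mem_comap, RingHom.mem_ker, RingHom.mem_ker,
    ← hcomp]
  rfl

variable [Fintype V]

theorem edgeBoundary_mem_ker_componentSum (e : G.edgeSet) :
    edgeBoundary (e : Sym2 V) ∈ LinearMap.ker (componentSum G) := by
  obtain ⟨e, he⟩ := e
  induction e with
  | h i j =>
    rw [LinearMap.mem_ker, edgeBoundary_mk, map_add, componentSum,
      Fintype.linearCombination_apply_single, Fintype.linearCombination_apply_single,
      SimpleGraph.ConnectedComponent.sound (SimpleGraph.Adj.reachable he)]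
    exact funext fun c => CharTwo.add_self_eq_zero (R := ZMod 2) _

/-- The boundary of an edge together with its degree modulo two. -/
def edgeVector (e : G.edgeSet) : (V → ZMod 2) × ZMod 2 := (edgeBoundary (e : Sym2 V), 1)

theorem finrank_span_edgeVector_le :
    Module.finrank (ZMod 2) (Submodule.span (ZMod 2) (Set.range (edgeVector G))) ≤
      Module.finrank (ZMod 2) (LinearMap.ker (componentSum G)) + 1 := by
  let f := LinearMap.prodMap (LinearMap.ker (componentSum G)).subtype
    (LinearMap.id : ZMod 2 →ₗ[ZMod 2] ZMod 2)
  have h : Submodule.span (ZMod 2) (Set.range (edgeVector G)) ≤ LinearMap.range f := by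
    rw [Submodule.span_le]
    rintro _ ⟨e, rfl⟩
    exact ⟨(⟨_, edgeBoundary_mem_ker_componentSum G e⟩, 1), rfl⟩
  refine (Submodule.finrank_mono h).trans (f.finrank_range_le.trans ?_)
  rw [Module.finrank_prod, Module.finrank_self]

theorem finrank_span_edgeVector_le_of_isBipartite (hG : G.IsBipartite) :
    Module.finrank (ZMod 2) (Submodule.span (ZMod 2) (Set.range (edgeVector G))) ≤
      Module.finrank (ZMod 2) (LinearMap.ker (componentSum G)) := by
  obtain ⟨col⟩ := hG
  -- With colours `0` and `1`, the two ends of every edge have colour sum `1`, so the last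
  -- coordinate is `l` of the boundary.
  let l : (V → ZMod 2) →ₗ[ZMod 2] ZMod 2 :=
    Fintype.linearCombination (ZMod 2) fun v => ((col v : ℕ) : ZMod 2)
  let f := (LinearMap.prod LinearMap.id l).comp (LinearMap.ker (componentSum G)).subtype
  have h : Submodule.span (ZMod 2) (Set.range (edgeVector G)) ≤ LinearMap.range f := by
    rw [Submodule.span_le]
    rintro _ ⟨e, rfl⟩
    refine ⟨⟨_, edgeBoundary_mem_ker_componentSum G e⟩, Prod.ext rfl ?_⟩
    change l (edgeBoundary (e : Sym2 V)) = 1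
    obtain ⟨e, he⟩ := e
    induction e with
    | h i j =>
      have hne : col i ≠ col j := col.valid he
      rw [edgeBoundary_mk, map_add]
      simp only [l, Fintype.linearCombination_apply_single, one_smul]
      revert hne
      generalize col i = a
      generalize col j = b
      revert a b
      decide
  exact (Submodule.finrank_mono h).trans f.finrank_range_le

theorem cmRegularityIdeal_graphIdeal_le [Nonempty V] [Fintype G.edgeSet] [DecidableEq G.edgeSet]
    (K : Type*) [Field K] (e : G.edgeSet) {N : ℕ}
    (hN : Module.finrank (ZMod 2) (Submodule.span (ZMod 2) (Set.range (edgeVector G))) ≤ N) :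
    cmRegularityIdeal (graphIdeal G K) ≤ (N : EReal) := by
  rw [cmRegularityIdeal, graphIdeal_eq_ker]
  -- The `- 1` absorbs the shift `reg I = reg (S/I) + 1`. The mod 2 vectors only match boundaries;
  -- the integral coordinate agrees because the degrees do.
  have h := cmRegularity_ker_monomialHom_le (K := K) (r := (N : ℤ) - 1)
    (fun e : G.edgeSet => (edgeBoundary (e : Sym2 V), (2 : ℤ))) e fun a ha => by
      obtain ⟨b, hb, hba⟩ := exists_linearCombination_add_eq (edgeVector G)
        (LinearMap.snd (ZMod 2) _ _) (fun _ => rfl) e a (by omega)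
      refine ⟨b, hb, Prod.ext ?_ ?_⟩
      · have h1 := congrArg Prod.fst hba
        have hfst : ∀ c : G.edgeSet →₀ ℕ,
            (Finsupp.linearCombination ℕ (edgeVector G) c).1 = (Finsupp.linearCombination ℕ
              (fun e : G.edgeSet => (edgeBoundary (e : Sym2 V), (2 : ℤ))) c).1 := fun c => by
          simp only [Finsupp.linearCombination_apply, Finsupp.sum, Prod.fst_sum, Prod.smul_fst]
          rfl
        rwa [hfst, hfst] at h1
      · have hsnd : ∀ c : G.edgeSet →₀ ℕ, (Finsupp.linearCombination ℕ
            (fun e : G.edgeSet => (edgeBoundary (e : Sym2 V), (2 : ℤ))) c).2 = c.degree * 2 :=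
          fun c => by
            simp [Finsupp.linearCombination_apply, Finsupp.sum, Prod.snd_sum, Finsupp.degree_apply,
              Finset.sum_mul]
        rw [hsnd, hsnd, map_add, Finsupp.degree_single, hb]
  refine (add_le_add_left h 1).trans (le_of_eq ?_)
  rw [← EReal.coe_one, ← EReal.coe_add, ← EReal.coe_natCast]
  congr 1
  push_cast
  ring

end Graph

theorem mainTheorem3 {V : Type*} [Fintype V] [DecidableEq V] [Nonempty V]
    (G : SimpleGraph V) [DecidableRel G.Adj] (hG : ∀ v, ∃ w, G.Adj v w)
    (K : Type*) [Field K] :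
    (G.IsBipartite →
      cmRegularityIdeal (graphIdeal G K) ≤
        (Fintype.card V : EReal) - (Nat.card G.ConnectedComponent : EReal)) ∧
    (¬ G.IsBipartite →
      cmRegularityIdeal (graphIdeal G K) ≤
        (Fintype.card V : EReal) - (Nat.card G.ConnectedComponent : EReal) + 1) := by
  obtain ⟨v⟩ := ‹Nonempty V›
  -- This edge supplies the variable `t_e`.
  obtain ⟨w, hvw⟩ := hG v
  have : Nonempty V := ⟨v⟩
  have hrank : (Fintype.card V : EReal) - (Nat.card G.ConnectedComponent : EReal) =
      (Module.finrank (ZMod 2) (LinearMap.ker (componentSum G)) : EReal) := by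
    rw [← finrank_ker_componentSum G, ← EReal.coe_natCast, ← EReal.coe_natCast,
      ← EReal.coe_natCast, ← EReal.coe_sub, Nat.cast_add, add_sub_cancel_left]
  rw [hrank]
  refine ⟨fun hb => cmRegularityIdeal_graphIdeal_le G K ⟨s(v, w), hvw⟩
    (finrank_span_edgeVector_le_of_isBipartite G hb), fun _ => ?_⟩
  rw [← Nat.cast_one, ← Nat.cast_add]
  exact cmRegularityIdeal_graphIdeal_le G K ⟨s(v, w), hvw⟩ (finrank_span_edgeVector_le G)
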